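/- Let $n\ge 0$ and $k\ge 1$ be integers, put $s_i=(2^k+1)2^{n+i}-(2^k-1)$ for $i\ge 0$, and let $GT(n,k)=\langle s_i : i\ge 0\rangle$ be the submonoid of $(\mathbb N,+)$ generated by all the $s_i$. For a submonoid $S\subseteq\mathbb N$ and $x\in S\setminus\{0\}$ let $\mathrm{Ap}(S,x)=\{w\in S : w-x\notin S\}$ (subtraction in $\mathbb Z$). Put $\delta=1$ if $n=0$, $\delta=k$ if $n\ne0$ and $k\le n$, and $\delta=k-1$ if $n\neq 0$ and $k>n$. For a sequence $t_1,t_2,\dots$ put $P_i=\sum_{j=1}^{i}(2^j-1)t_j$ and $Q_i=\sum_{j=1}^{i}t_js_j$. For $d\ge 1$ let $A(n,d)$ be the set of all $(t_1,\dots,t_{n+d})\in\{0,1,2\}^{n+d}$ such that $t_{n+d}\in\{0,1\}$ and, whenever $t_j=2$, $t_i=0$ for all $i<j$. Define the following sets of sequences. * $R(n)$ (for $n\ge1$) is the set of all $(t_1,\dots,t_{n+1})\in A(n,1)$ such that: $t_{n+1}\in\{0,1\}$; if $t_n=2$ then $t_{n+1}=0$; if $t_n=t_{n+1}=1$ then $t_i=0$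 for all $1\le i<n$. * $R_1(n,\delta)$ (for $2\le k<n$) is the set of all $(t_1,\dots,t_{n+\delta})\in A(n,\delta)$ such that, if $t_{n+\delta}=1$, then: $t_n=\dots=t_{n+\delta-1}=0$; $t_{n-1}\in\{0,1\}$; and if $t_{n-1}=1$ then $P_{n-2}\le 2^{n-1}-2^k+2$. * $R_2(n,\delta)$ (for $n=k\ge1$, so that $n+\delta=2n$) is the set of all $(t_1,\dots,t_{2n})\in A(n,\delta)$ such that, if $t_{2n}=1$, then $t_1\in\{0,1\}$ and $t_2=\dots=t_{2n-1}=0$. * $R_3(n,\delta)$ (for $n\ge1$, $k>n$, $k\ne2$) is the set of all $(t_1,\dots,t_{n+\delta})\in A(n,\delta)$ such that: if $t_{\delta+1}=\dots=t_{n+\delta}=1$ then $P_\delta\le 2^n+n$; and there is no $j$ with $\delta+1\le j\le n+\delta-1$, $t_j=2$ and $t_{j+1}=\dots=t_{n+\delta}=1$. Then $$\mathrm{Ap}(GT(n,k),s_0)=\begin{cases} \{0,s_1\} & \text{if } n=0,\\ \{Q_{n+1} : (t_1,\dots,t_{n+1})\in R(n)\} & \text{if } n\ne0,\ k=1,\\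 \{Q_{n+\delta} : (t_1,\dots,t_{n+\delta})\in R_1(n,\delta)\} & \text{if } 2\le k<n,\\ \{Q_{n+\delta} : (t_1,\dots,t_{n+\delta})\in R_2(n,\delta)\} & \text{if } n=k\ge1,\\ \{Q_{n+\delta} : (t_1,\dots,t_{n+\delta})\in R_3(n,\delta)\} & \text{if } n\ne0,\ k>n,\ k\ne2,\\ \{0,17,34,37,54,71,74\} & \text{if } n=1,\ k=2. \end{cases}$$ Moreover $\mathrm{Ap}(GT(n,k),s_0)$ has exactly $s_0$ elements, $\mathbb N\setminus GT(n,k)$ is finite, and its cardinality $g(GT(n,k))$ is $$g(GT(n,k))=\frac1{s_0}\sum_{w\in \mathrm{Ap}(GT(n,k),s_0)}w-\frac{s_0-1}{2}.$$ -/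

import Mathlib

namespace GenThabit

/-- `s n k i = (2^k + 1) * 2^(n+i) - (2^k - 1)`; both subtractions are exact in `ℕ`. -/
def s (n k i : ℕ) : ℕ := (2 ^ k + 1) * 2 ^ (n + i) - (2 ^ k - 1)

/-- The generalized Thabit numerical semigroup, the submonoid of `(ℕ, +)` generated by all
`s n k i`, `i ∈ ℕ`. -/
def GT (n k : ℕ) : AddSubmonoid ℕ := AddSubmonoid.closure (Set.range (s n k))

/-- The Apéry set `{w ∈ S | w - x ∉ S}`. The subtraction is that of `ℤ`, so `w - x ∈ S` means
that `w = t + x` for some `t ∈ S`. -/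
def Apery (S : AddSubmonoid ℕ) (x : ℕ) : Set ℕ := {w | w ∈ S ∧ ¬ ∃ t ∈ S, w = t + x}

/-- The number of natural numbers outside `S`. -/
noncomputable def genus (S : AddSubmonoid ℕ) : ℕ := ((S : Set ℕ)ᶜ).ncard

def delta (n k : ℕ) : ℕ := if n = 0 then 1 else if k ≤ n then k else k - 1

/-- `P t i = t_1 + (2^2 - 1) t_2 + ⋯ + (2^i - 1) t_i`. -/
def P (t : ℕ → ℕ) (i : ℕ) : ℕ := ∑ j ∈ Finset.Icc 1 i, (2 ^ j - 1) * t j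

/-- `Q n k t i = t_1 s_1 + ⋯ + t_i s_i`. -/
def Q (n k : ℕ) (t : ℕ → ℕ) (i : ℕ) : ℕ := ∑ j ∈ Finset.Icc 1 i, t j * s n k j

/-- `A(n, δ)`. A sequence `(t_1, …, t_{n+δ})` is a function `t : ℕ → ℕ` that vanishes outside
the indices `1, …, n + δ`. -/
def A (n δ : ℕ) : Set (ℕ → ℕ) :=
  {t | (∀ i, i ∉ Finset.Icc 1 (n + δ) → t i = 0) ∧
    (∀ i ∈ Finset.Icc 1 (n + δ), t i ∈ ({0, 1, 2} : Set ℕ)) ∧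
    t (n + δ) ∈ ({0, 1} : Set ℕ) ∧
    ∀ j ∈ Finset.Icc 1 (n + δ), t j = 2 → ∀ i, 1 ≤ i → i < j → t i = 0}

/-- `R(n)`, used for `k = 1`, where `δ = 1`. -/
def R (n : ℕ) : Set (ℕ → ℕ) :=
  {t | t ∈ A n 1 ∧ t (n + 1) ∈ ({0, 1} : Set ℕ) ∧
    (t n = 2 → t (n + 1) = 0) ∧
    (t n = 1 → t (n + 1) = 1 → ∀ i, 1 ≤ i → i < n → t i = 0)}

/-- `R_1(n, δ)`, used for `2 ≤ k < n`; for such `n, k` the subtractions are exact. -/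
def R₁ (n k : ℕ) : Set (ℕ → ℕ) :=
  {t | t ∈ A n (delta n k) ∧ (t (n + delta n k) = 1 →
    (∀ i, n ≤ i → i ≤ n + delta n k - 1 → t i = 0) ∧
    t (n - 1) ∈ ({0, 1} : Set ℕ) ∧
    (t (n - 1) = 1 → P t (n - 2) ≤ 2 ^ (n - 1) - 2 ^ k + 2))}

/-- `R_2(n, δ)`, used for `n = k ≥ 1`, where `n + δ = 2n`. -/
def R₂ (n k : ℕ) : Set (ℕ → ℕ) :=
  {t | t ∈ A n (delta n k) ∧ (t (2 * n) = 1 →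
    t 1 ∈ ({0, 1} : Set ℕ) ∧ ∀ i, 2 ≤ i → i ≤ 2 * n - 1 → t i = 0)}

/-- `R_3(n, δ)`, used for `n ≥ 1`, `k > n`, `k ≠ 2`. -/
def R₃ (n k : ℕ) : Set (ℕ → ℕ) :=
  {t | t ∈ A n (delta n k) ∧
    ((∀ i, delta n k + 1 ≤ i → i ≤ n + delta n k → t i = 1) →
      P t (delta n k) ≤ 2 ^ n + n) ∧
    ¬ ∃ j, delta n k + 1 ≤ j ∧ j ≤ n + delta n k - 1 ∧ t j = 2 ∧
      ∀ i, j + 1 ≤ i → i ≤ n + delta n k → t i = 1}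

end GenThabit

namespace GenThabit

/-! ### Apéry sets and Selmer's formula -/

/-! Put `M = step n k = (2^k+1)2^n`. Since `s_i = s_0 + M(2^i - 1)`, the elements of `GT n k` are
the `s_0 N + M p` with `p` a sum of `N` numbers `2^i - 1` (`mem_GT_iff`). As `M` is coprime to
`s_0`, the residue mod `s_0` depends only on `p` mod `s_0`. As `M ≥ s_0`, reducing `p` mod `s_0`
leaves more summands than are needed. So the Apéry set is `{s_0 ℓ(p) + M p : p < s_0}` with `ℓ =
mersenneLength` (`Apery_GT_eq`).

Greedy digits, where a 2 forces zeros below it, represent all `p ≤ 2^(L+1) - 2` and attain `ℓ(p)`.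
Optimality comes from counting bits: `p + N` is a sum of `N` powers of two, so it has at most `N`
ones (`IsGreedy.mersenneLength_P`). The sets `R`, `R₁`, `R₂`, `R₃` spell out `P t < s_0` in digits.
The genus follows by counting gaps in each residue class. -/

theorem mem_iff_of_modEq_of_mem_Apery {S : AddSubmonoid ℕ} {x w y : ℕ} (hx : x ∈ S)
    (hw : w ∈ Apery S x) (h : y ≡ w [MOD x]) : y ∈ S ↔ w ≤ y := by
  constructor
  · intro hy
    by_contra! hlt
    obtain ⟨c, hc⟩ := (Nat.modEq_iff_dvd' hlt.le).1 h
    obtain _ | c := c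
    · omega
    · refine hw.2 ⟨y + c • x, S.add_mem hy (S.nsmul_mem hx c), ?_⟩
      rw [smul_eq_mul]
      have : x * (c + 1) = c * x + x := by ring
      omega
  · intro hle
    obtain ⟨c, hc⟩ := (Nat.modEq_iff_dvd' hle).1 h.symm
    have : y = w + c • x := by rw [smul_eq_mul, mul_comm]; omega
    rw [this]
    exact S.add_mem hw.1 (S.nsmul_mem hx c)

section Selmer

variable {S : AddSubmonoid ℕ} {x : ℕ} {f : ℕ → ℕ}

/-- If the Apéry set is enumerated by `f` on `{0, …, x - 1}`, injectively modulo `x`, then so are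
the residues modulo `x`. -/
theorem image_mod_eq_range (hx0 : 0 < x)
    (hf : ∀ p < x, ∀ q < x, f p ≡ f q [MOD x] → p = q) :
    (Finset.range x).image (fun p ↦ f p % x) = Finset.range x := by
  apply Finset.eq_of_subset_of_card_le
  · intro r
    simp only [Finset.mem_image, Finset.mem_range]
    rintro ⟨p, -, rfl⟩
    exact Nat.mod_lt _ hx0
  · rw [Finset.card_image_of_injOn]
    intro p hp q hq h
    exact hf p (by simpa using hp) q (by simpa using hq) h

/-- The gaps in the class of `f p` are the smaller members of that class, and there are `f p / x` of
them. -/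
theorem compl_eq_image (hx0 : 0 < x) (hx : x ∈ S)
    (hA : Apery S x = ((Finset.range x).image f : Finset ℕ))
    (hf : ∀ p < x, ∀ q < x, f p ≡ f q [MOD x] → p = q) :
    ((S : Set ℕ)ᶜ) = (((Finset.range x).sigma fun p ↦ Finset.range (f p / x)).image
      fun a ↦ f a.1 % x + x * a.2 : Finset ℕ) := by
  have hmem : ∀ p < x, f p ∈ Apery S x := fun p hp ↦ by
    rw [hA]; exact Finset.mem_coe.2 (Finset.mem_image_of_mem f (Finset.mem_range.2 hp))
  ext y
  simp only [Set.mem_compl_iff, SetLike.mem_coe, Finset.coe_image, Set.mem_image,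
    Finset.mem_sigma, Finset.mem_range, Sigma.exists]
  constructor
  · intro hy
    have : y % x ∈ (Finset.range x).image (fun p ↦ f p % x) := by
      rw [image_mod_eq_range hx0 hf]; exact Finset.mem_range.2 (Nat.mod_lt _ hx0)
    obtain ⟨p, hp, hpy⟩ := Finset.mem_image.1 this
    rw [Finset.mem_range] at hp
    rw [mem_iff_of_modEq_of_mem_Apery hx (hmem p hp) hpy.symm, not_le] at hy
    refine ⟨p, y / x, ⟨hp, ?_⟩, ?_⟩
    · by_contra! h
      have h1 := Nat.mul_le_mul_left x h
      have h2 := Nat.mod_add_div y x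
      have h3 := Nat.mod_add_div (f p) x
      omega
    · rw [hpy, Nat.mod_add_div]
  · rintro ⟨p, j, ⟨hp, hj⟩, rfl⟩
    rw [mem_iff_of_modEq_of_mem_Apery hx (hmem p hp) (by simp [Nat.ModEq]), not_le]
    have h1 := Nat.mul_lt_mul_of_pos_left hj hx0
    have h3 := Nat.mod_add_div (f p) x
    omega

theorem ncard_compl_eq_sum (hx0 : 0 < x) (hx : x ∈ S)
    (hA : Apery S x = ((Finset.range x).image f : Finset ℕ))
    (hf : ∀ p < x, ∀ q < x, f p ≡ f q [MOD x] → p = q) :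
    ((S : Set ℕ)ᶜ).ncard = ∑ p ∈ Finset.range x, f p / x := by
  rw [compl_eq_image hx0 hx hA hf, Set.ncard_coe_finset, Finset.card_image_of_injOn]
  · simp
  · rintro ⟨p, i⟩ hp ⟨q, j⟩ hq h
    simp only [Finset.coe_sigma, Set.mem_sigma_iff, Finset.coe_range, Set.mem_Iio] at hp hq h
    have h1 : p = q := hf p hp.1 q hq.1 (by
      have := congrArg (· % x) h
      simpa [Nat.ModEq] using this)
    subst h1
    have : x * i = x * j := by omega
    rw [Nat.eq_of_mul_eq_mul_left hx0 this]

/-- Selmer's formula for the number of gaps of a numerical semigroup. -/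
theorem genus_eq (hx0 : 0 < x) (hx : x ∈ S)
    (hA : Apery S x = ((Finset.range x).image f : Finset ℕ))
    (hf : ∀ p < x, ∀ q < x, f p ≡ f q [MOD x] → p = q) :
    (genus S : ℚ) = 1 / (x : ℚ) * (∑ᶠ w ∈ Apery S x, (w : ℚ)) - ((x : ℚ) - 1) / 2 := by
  have hinj : Set.InjOn f (Finset.range x) := fun p hp q hq h ↦
    hf p (by simpa using hp) q (by simpa using hq) (by rw [h])
  rw [hA, finsum_mem_coe_finset, Finset.sum_image hinj, genus, ncard_compl_eq_sum hx0 hx hA hf]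
  -- The residues are `0, …, x - 1` in some order, which produces the term `(x - 1)/2`; the
  -- quotients count the gaps.
  have h1 : ∑ p ∈ Finset.range x, f p % x = ∑ r ∈ Finset.range x, r := by
    conv_rhs => rw [← image_mod_eq_range hx0 hf]
    rw [Finset.sum_image]
    intro p hp q hq h
    exact hf p (by simpa using hp) q (by simpa using hq) h
  have h2 : ∑ p ∈ Finset.range x, f p =
      (∑ r ∈ Finset.range x, r) + x * ∑ p ∈ Finset.range x, f p / x := by
    rw [← h1, Finset.mul_sum, ← Finset.sum_add_distrib]
    exact Finset.sum_congr rfl fun p _ ↦ (Nat.mod_add_div _ _).symm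
  have h3 : ((∑ r ∈ Finset.range x, r : ℕ) : ℚ) * 2 = x * (x - 1) := by
    rw [← Nat.cast_ofNat, ← Nat.cast_mul, Finset.sum_range_id_mul_two, Nat.cast_mul,
      Nat.cast_pred hx0]
  have h4 : (x : ℚ) ≠ 0 := by positivity
  rw [← Nat.cast_sum, h2]
  push_cast at h3 ⊢
  field_simp
  linarith

end Selmer
/-! ### Counting binary digits -/

/-- The number of ones in the binary expansion. -/
def bitCount (a : ℕ) : ℕ := (Nat.digits 2 a).sum

theorem bitCount_zero : bitCount 0 = 0 := by simp [bitCount]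

theorem bitCount_two_mul (a : ℕ) : bitCount (2 * a) = bitCount a := by
  rcases Nat.eq_zero_or_pos a with rfl | h
  · rfl
  · simp [bitCount, Nat.digits_def' (b := 2) one_lt_two (n := 2 * a) (by omega)]

theorem bitCount_two_mul_add_one (a : ℕ) : bitCount (2 * a + 1) = bitCount a + 1 := by
  rw [bitCount, Nat.digits_def' (b := 2) one_lt_two (n := 2 * a + 1) (by omega)]
  have h1 : (2 * a + 1) % 2 = 1 := by omega
  have h2 : (2 * a + 1) / 2 = a := by omega
  rw [h1, h2, List.sum_cons, bitCount, add_comm]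

theorem bitCount_add_le (a b : ℕ) : bitCount (a + b) ≤ bitCount a + bitCount b := by
  induction h : a + b using Nat.strong_induction_on generalizing a b with
  | _ m ih =>
    subst h
    obtain ⟨a', rfl | rfl⟩ := Nat.even_or_odd' a <;> obtain ⟨b', rfl | rfl⟩ := Nat.even_or_odd' b
    · rcases Nat.eq_zero_or_pos (a' + b') with h | h
      · have : a' = 0 := by omega
        have : b' = 0 := by omega
        subst a' b'
        simp [bitCount_zero]
      · rw [← mul_add, bitCount_two_mul, bitCount_two_mul, bitCount_two_mul]
        exact ih _ (by omega) _ _ rfl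
    · rw [← add_assoc, ← mul_add, bitCount_two_mul_add_one, bitCount_two_mul,
        bitCount_two_mul_add_one]
      have := ih (a' + b') (by omega) _ _ rfl
      omega
    · rw [show 2 * a' + 1 + 2 * b' = 2 * (a' + b') + 1 by ring, bitCount_two_mul_add_one,
        bitCount_two_mul, bitCount_two_mul_add_one]
      have := ih (a' + b') (by omega) _ _ rfl
      omega
    · rw [show 2 * a' + 1 + (2 * b' + 1) = 2 * (a' + b' + 1) by ring, bitCount_two_mul,
        bitCount_two_mul_add_one, bitCount_two_mul_add_one]
      -- The carry is treated as a further summand 1, so the induction hypothesis is used twice.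
      have h1 := ih (a' + b' + 1) (by omega) (a' + b') 1 rfl
      have h2 := ih (a' + b') (by omega) _ _ rfl
      have h3 : bitCount 1 = 1 := by simp [bitCount]
      omega

theorem bitCount_two_pow (i : ℕ) : bitCount (2 ^ i) = 1 := by
  induction i with
  | zero => simp [bitCount]
  | succ i ih => rw [pow_succ', bitCount_two_mul, ih]

theorem bitCount_add_two_pow {L a : ℕ} (h : a < 2 ^ L) :
    bitCount (a + 2 ^ L) = bitCount a + 1 := by
  induction L generalizing a with
  | zero =>
    have : a = 0 := by simpa using h
    subst this
    simp [bitCount]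
  | succ L ih =>
    rw [pow_succ'] at h ⊢
    obtain ⟨b, rfl | rfl⟩ := Nat.even_or_odd' a
    · rw [← mul_add, bitCount_two_mul, bitCount_two_mul, ih (by omega)]
    · rw [show 2 * b + 1 + 2 * 2 ^ L = 2 * (b + 2 ^ L) + 1 by ring, bitCount_two_mul_add_one,
        bitCount_two_mul_add_one, ih (by omega)]

theorem bitCount_two_pow_sub_one (L : ℕ) : bitCount (2 ^ L - 1) = L := by
  induction L with
  | zero => simp [bitCount]
  | succ L ih =>
    have h := Nat.one_le_two_pow (n := L)
    rw [show 2 ^ (L + 1) - 1 = 2 * (2 ^ L - 1) + 1 by rw [pow_succ']; omega,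
      bitCount_two_mul_add_one, ih]

/-! ### Sums of numbers `2 ^ i - 1` -/

/-- The pairs `(N, p)` such that `p` is a sum of `N` numbers of the form `2 ^ i - 1`. -/
def mersenneSums : AddSubmonoid (ℕ × ℕ) :=
  AddSubmonoid.closure (Set.range fun i : ℕ ↦ (1, 2 ^ i - 1))

theorem one_mem_mersenneSums (i : ℕ) : (1, 2 ^ i - 1) ∈ mersenneSums :=
  AddSubmonoid.subset_closure ⟨i, rfl⟩

/-- Pad with the summand `2^0 - 1 = 0`. -/
theorem mersenneSums_mono {N N' p : ℕ} (h : (N, p) ∈ mersenneSums) (hN : N ≤ N') :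
    (N', p) ∈ mersenneSums := by
  have := mersenneSums.add_mem h (mersenneSums.nsmul_mem (one_mem_mersenneSums 0) (N' - N))
  simpa [Nat.add_sub_cancel' hN] using this

theorem self_mem_mersenneSums (p : ℕ) : (p, p) ∈ mersenneSums := by
  simpa using mersenneSums.nsmul_mem (one_mem_mersenneSums 1) p

/-- Adding 1 to each summand gives a sum of powers of two, and `bitCount` is subadditive. -/
theorem bitCount_le_of_mem_mersenneSums {x : ℕ × ℕ} (h : x ∈ mersenneSums) :
    bitCount (x.2 + x.1) ≤ x.1 := by
  induction h using AddSubmonoid.closure_induction with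
  | mem x hx =>
    obtain ⟨i, rfl⟩ := hx
    simp only
    rw [Nat.sub_add_cancel Nat.one_le_two_pow, bitCount_two_pow]
  | zero => simp [bitCount_zero]
  | add x y _ _ hx hy =>
    have := bitCount_add_le (x.2 + x.1) (y.2 + y.1)
    rw [Prod.fst_add, Prod.snd_add, add_add_add_comm]
    omega

/-- The least number of summands `2 ^ i - 1` that add up to `p`. -/
noncomputable def mersenneLength (p : ℕ) : ℕ := sInf {N | (N, p) ∈ mersenneSums}

theorem mersenneLength_mem (p : ℕ) : (mersenneLength p, p) ∈ mersenneSums :=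
  Nat.sInf_mem (s := {N | (N, p) ∈ mersenneSums}) ⟨p, self_mem_mersenneSums p⟩

theorem mersenneLength_le {N p : ℕ} (h : (N, p) ∈ mersenneSums) : mersenneLength p ≤ N :=
  Nat.sInf_le (s := {N | (N, p) ∈ mersenneSums}) h

theorem mersenneLength_le_self (p : ℕ) : mersenneLength p ≤ p :=
  mersenneLength_le (self_mem_mersenneSums p)

/-- A shorter representation could be padded to exactly `N - 1` summands, and then `p + N - 1` would
have at most `N - 1` ones. -/
theorem mersenneLength_eq {N p : ℕ} (h : (N, p) ∈ mersenneSums)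
    (hN : N ≤ bitCount (p + N - 1)) : mersenneLength p = N := by
  apply le_antisymm (mersenneLength_le h)
  by_contra! hlt
  have h1 := bitCount_le_of_mem_mersenneSums
    (mersenneSums_mono (mersenneLength_mem p) (Nat.le_sub_one_of_lt hlt))
  simp only at h1
  rw [← Nat.add_sub_assoc (by omega)] at h1
  omega

/-! ### Greedy digit sequences -/

/-- The condition on the digits in the definition of `A n δ`. -/
def IsGreedy (t : ℕ → ℕ) : Prop :=
  ∀ j, t j ≤ 2 ∧ (t j = 2 → ∀ i, 1 ≤ i → i < j → t i = 0)

theorem P_zero (t : ℕ → ℕ) : P t 0 = 0 := by simp [P]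

theorem P_succ (t : ℕ → ℕ) (i : ℕ) : P t (i + 1) = P t i + (2 ^ (i + 1) - 1) * t (i + 1) := by
  rw [P, P, Finset.sum_Icc_succ_top (by omega)]

theorem P_congr {t u : ℕ → ℕ} {L : ℕ} (h : ∀ i, 1 ≤ i → i ≤ L → t i = u i) : P t L = P u L := by
  refine Finset.sum_congr rfl fun j hj ↦ ?_
  rw [Finset.mem_Icc] at hj
  rw [h j hj.1 hj.2]

theorem P_eq_zero_iff {t : ℕ → ℕ} {L : ℕ} : P t L = 0 ↔ ∀ i, 1 ≤ i → i ≤ L → t i = 0 := by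
  rw [P, Finset.sum_eq_zero_iff]
  constructor
  · intro h i hi hL
    have := h i (Finset.mem_Icc.2 ⟨hi, hL⟩)
    have h2 := Nat.pow_le_pow_right (n := 2) two_pos hi
    rcases Nat.mul_eq_zero.1 this with h3 | h3 <;> omega
  · intro h i hi
    rw [Finset.mem_Icc] at hi
    rw [h i hi.1 hi.2, mul_zero]

theorem le_P {t : ℕ → ℕ} {i j : ℕ} (h1 : 1 ≤ i) (h : i ≤ j) (ht : t i ≠ 0) :
    2 ^ i - 1 ≤ P t j := by
  calc 2 ^ i - 1 ≤ (2 ^ i - 1) * t i := Nat.le_mul_of_pos_right _ (Nat.pos_of_ne_zero ht)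
    _ ≤ P t j := Finset.single_le_sum (f := fun j ↦ (2 ^ j - 1) * t j) (fun _ _ ↦ Nat.zero_le _)
        (Finset.mem_Icc.2 ⟨h1, h⟩)

theorem P_eq_of_eq_zero {t : ℕ → ℕ} {i j : ℕ} (h : i ≤ j)
    (ht : ∀ l, i + 1 ≤ l → l ≤ j → t l = 0) : P t j = P t i := by
  induction j, h using Nat.le_induction with
  | base => rfl
  | succ j hj ih =>
    rw [P_succ, ht (j + 1) (by omega) le_rfl, mul_zero, add_zero]
    exact ih fun l h1 h2 ↦ ht l h1 (by omega)

theorem P_of_eq_one {t : ℕ → ℕ} {i j : ℕ} (h : i ≤ j)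
    (ht : ∀ l, i + 1 ≤ l → l ≤ j → t l = 1) :
    P t j + 2 ^ (i + 1) + (j - i) = P t i + 2 ^ (j + 1) := by
  induction j, h using Nat.le_induction with
  | base => omega
  | succ j hj ih =>
    have := ih fun l h1 h2 ↦ ht l h1 (by omega)
    have h1 := Nat.one_le_two_pow (n := j + 1)
    rw [P_succ, ht (j + 1) (by omega) le_rfl, mul_one, pow_succ 2 (j + 1)]
    omega

theorem IsGreedy.P_add_two_le {t : ℕ → ℕ} (ht : IsGreedy t) (L : ℕ) : P t L + 2 ≤ 2 ^ (L + 1) := by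
  induction L with
  | zero => simp [P_zero]
  | succ L ih =>
    obtain ⟨h1, h2⟩ := ht (L + 1)
    rw [P_succ, pow_succ 2 (L + 1)]
    have h3 : 2 ≤ 2 ^ (L + 1) := by omega
    interval_cases h : t (L + 1)
    · omega
    · omega
    · rw [P_eq_zero_iff.2 fun i hi hL ↦ h2 rfl i hi (by omega)]
      omega

/-- The top digit of weight `W = 2^(L+1) - 1` is 0 for `p < W`, 1 for `W ≤ p < 2W`, and 2 only for
`p = 2W`, where nothing remains. -/
theorem exists_isGreedy_P_eq {L p : ℕ} (h : p + 2 ≤ 2 ^ (L + 1)) :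
    ∃ t, IsGreedy t ∧ (∀ i, i ∉ Finset.Icc 1 L → t i = 0) ∧ P t L = p := by
  induction L generalizing p with
  | zero => exact ⟨0, fun j ↦ by simp, fun _ _ ↦ rfl, by rw [P_zero]; omega⟩
  | succ L ih =>
    have hpow := pow_succ 2 (L + 1)
    have hone := Nat.pow_le_pow_right (n := 2) two_pos (show 1 ≤ L + 1 by omega)
    have key : ∀ (u : ℕ → ℕ) (c : ℕ), IsGreedy u → (∀ i, i ∉ Finset.Icc 1 L → u i = 0) →
        c ≤ 2 → (c = 2 → u = 0) → P u L + (2 ^ (L + 1) - 1) * c = p →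
        ∃ t, IsGreedy t ∧ (∀ i, i ∉ Finset.Icc 1 (L + 1) → t i = 0) ∧ P t (L + 1) = p := by
      intro u c hu hu0 hc hc2 hp
      refine ⟨Function.update u (L + 1) c, fun j ↦ ?_, fun i hi ↦ ?_, ?_⟩
      · rcases eq_or_ne j (L + 1) with rfl | hj
        · rw [Function.update_self]
          refine ⟨hc, fun h i _ h2 ↦ ?_⟩
          rw [Function.update_of_ne h2.ne, hc2 h, Pi.zero_apply]
        · rw [Function.update_of_ne hj]
          refine ⟨(hu j).1, fun h i h1 h2 ↦ ?_⟩
          have : j ∈ Finset.Icc 1 L := by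
            by_contra h3
            rw [hu0 j h3] at h
            omega
          rw [Finset.mem_Icc] at this
          rw [Function.update_of_ne (by omega)]
          exact (hu j).2 h i h1 h2
      · rw [Finset.mem_Icc] at hi
        rw [Function.update_of_ne (by rintro rfl; omega)]
        exact hu0 i (by rw [Finset.mem_Icc]; omega)
      · rw [P_succ, Function.update_self, ← hp,
          P_congr fun i _ hi ↦ Function.update_of_ne (by omega) c u]
    by_cases h1 : p + 2 ≤ 2 ^ (L + 1)
    · obtain ⟨u, hu, hu0, hp⟩ := ih h1
      exact key u 0 hu hu0 (by omega) (by omega) (by omega)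
    by_cases h2 : p + 3 ≤ 2 * 2 ^ (L + 1)
    · obtain ⟨u, hu, hu0, hp⟩ := ih (p := p - (2 ^ (L + 1) - 1)) (by omega)
      exact key u 1 hu hu0 (by omega) (by omega) (by omega)
    · refine key 0 2 (fun j ↦ by simp) (fun _ _ ↦ rfl) le_rfl (fun _ ↦ rfl) ?_
      rw [(P_eq_zero_iff (t := 0)).2 fun _ _ _ ↦ rfl]
      omega

/-- The digit sum `t_1 + ⋯ + t_L`. -/
def digitSum (t : ℕ → ℕ) (L : ℕ) : ℕ := ∑ j ∈ Finset.Icc 1 L, t j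

theorem digitSum_succ (t : ℕ → ℕ) (L : ℕ) : digitSum t (L + 1) = digitSum t L + t (L + 1) := by
  rw [digitSum, digitSum, Finset.sum_Icc_succ_top (by omega)]

theorem digitSum_mem_mersenneSums (t : ℕ → ℕ) (L : ℕ) :
    (digitSum t L, P t L) ∈ mersenneSums := by
  induction L with
  | zero => exact mersenneSums.zero_mem
  | succ L ih =>
    rw [digitSum_succ, P_succ]
    simpa [mul_comm] using
      mersenneSums.add_mem ih (mersenneSums.nsmul_mem (one_mem_mersenneSums (L + 1)) (t (L + 1)))

theorem digitSum_eq_zero_of_P_eq_zero {t : ℕ → ℕ} {L : ℕ} (h : P t L = 0) :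
    digitSum t L = 0 := by
  rw [P_eq_zero_iff] at h
  refine Finset.sum_eq_zero fun i hi ↦ ?_
  rw [Finset.mem_Icc] at hi
  exact h i hi.1 hi.2

/-- The left side is `∑ t_j 2^j`. The bound leaves bit `L + 1` of this sum minus 1 free, so a
further digit 1 adds a bit without a carry. -/
theorem IsGreedy.P_add_digitSum_le {t : ℕ → ℕ} (ht : IsGreedy t) (L : ℕ) :
    P t L + digitSum t L ≤ 2 ^ (L + 1) := by
  induction L with
  | zero => simp [P_zero, digitSum]
  | succ L ih =>
    obtain ⟨h1, h2⟩ := ht (L + 1)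
    rw [P_succ, digitSum_succ, pow_succ 2 (L + 1)]
    have h3 := Nat.one_le_two_pow (n := L + 1)
    interval_cases h : t (L + 1)
    · omega
    · omega
    · have h4 := P_eq_zero_iff.2 fun i hi (hL : i ≤ L) ↦ h2 rfl i hi (by omega)
      rw [h4, digitSum_eq_zero_of_P_eq_zero h4]
      omega

theorem IsGreedy.digitSum_le_bitCount {t : ℕ → ℕ} (ht : IsGreedy t) (L : ℕ) :
    digitSum t L ≤ bitCount (P t L + digitSum t L - 1) := by
  induction L with
  | zero => simp [digitSum]
  | succ L ih =>
    obtain ⟨h1, h2⟩ := ht (L + 1)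
    have h3 := Nat.one_le_two_pow (n := L + 1)
    have h5 := ht.P_add_digitSum_le L
    rw [P_succ, digitSum_succ]
    -- With zero lower digits the `- 1` borrows from the top digit and leaves a number `2^m - 1`,
    -- all ones; a top digit 2 occurs only here.
    rcases Nat.eq_zero_or_pos (digitSum t L) with h0 | h0
    · have hP : P t L = 0 := P_eq_zero_iff.2 fun i hi hL ↦
        Finset.sum_eq_zero_iff.1 h0 i (Finset.mem_Icc.2 ⟨hi, hL⟩)
      rw [hP, h0]
      interval_cases h : t (L + 1)
      · simp
      · rw [show 0 + (2 ^ (L + 1) - 1) * 1 + (0 + 1) - 1 = 2 ^ (L + 1) - 1 by omega,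
          bitCount_two_pow_sub_one]
        omega
      · rw [show 0 + (2 ^ (L + 1) - 1) * 2 + (0 + 2) - 1 = 2 ^ (L + 2) - 1 by
          rw [pow_succ 2 (L + 1)]; omega, bitCount_two_pow_sub_one]
        omega
    · interval_cases h : t (L + 1)
      · simpa using ih
      · rw [show P t L + (2 ^ (L + 1) - 1) * 1 + (digitSum t L + 1) - 1 =
          P t L + digitSum t L - 1 + 2 ^ (L + 1) by omega, bitCount_add_two_pow (by omega)]
        omega
      · have := digitSum_eq_zero_of_P_eq_zero
          (P_eq_zero_iff.2 fun i hi (hL : i ≤ L) ↦ h2 rfl i hi (by omega))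
        omega

theorem IsGreedy.mersenneLength_P {t : ℕ → ℕ} (ht : IsGreedy t) (L : ℕ) :
    mersenneLength (P t L) = digitSum t L :=
  mersenneLength_eq (digitSum_mem_mersenneSums t L) (ht.digitSum_le_bitCount L)

/-! ### The Apéry set of the generalized Thabit semigroup -/

/-- The increment `(2 ^ k + 1) * 2 ^ n`, for which `s n k i = s n k 0 + step n k * (2 ^ i - 1)`. -/
def step (n k : ℕ) : ℕ := (2 ^ k + 1) * 2 ^ n

theorem s_zero_add (n k : ℕ) : s n k 0 + 2 ^ k = 2 ^ (n + k) + 2 ^ n + 1 := by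
  have h1 := Nat.one_le_two_pow (n := k)
  have h2 : 2 ^ k ≤ 2 ^ (n + k) := Nat.pow_le_pow_right two_pos (by omega)
  have h3 := Nat.one_le_two_pow (n := n)
  rw [s, add_zero, add_mul, one_mul, ← pow_add, add_comm k n]
  omega

theorem step_eq (n k : ℕ) : step n k = 2 ^ (n + k) + 2 ^ n := by
  rw [step, add_mul, one_mul, ← pow_add, add_comm k n]

theorem s_eq (n k i : ℕ) : s n k i = s n k 0 + step n k * (2 ^ i - 1) := by
  have h1 := s_zero_add n k
  have h2 := Nat.one_le_two_pow (n := i)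
  have h3 := Nat.one_le_two_pow (n := k)
  have h4 := step_eq n k
  have h5 : step n k * 1 ≤ step n k * 2 ^ i := Nat.mul_le_mul_left _ h2
  have h6 : s n k i = step n k * 2 ^ i - (2 ^ k - 1) := by rw [s, pow_add, ← mul_assoc, step]
  have h7 := Nat.one_le_two_pow (n := n)
  have h8 : 2 ^ k ≤ 2 ^ (n + k) := Nat.pow_le_pow_right two_pos (by omega)
  rw [h6, Nat.mul_sub]
  omega

theorem s_zero_pos (n k : ℕ) : 0 < s n k 0 := by
  have h1 := s_zero_add n k
  have h2 : 2 ^ k ≤ 2 ^ (n + k) := Nat.pow_le_pow_right two_pos (by omega)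
  have h3 := Nat.one_le_two_pow (n := n)
  omega

theorem s_zero_le_step (n k : ℕ) : s n k 0 ≤ step n k := by
  have h1 := s_zero_add n k
  have h2 := step_eq n k
  have h3 := Nat.one_le_two_pow (n := k)
  omega

/-- The difference `step n k - s n k 0 = 2^k - 1` is odd, hence coprime to `2^k + 1` and to `2^n`.
-/
theorem coprime_s_zero_step {k : ℕ} (n : ℕ) (hk : 1 ≤ k) : Nat.Coprime (s n k 0) (step n k) := by
  have h1 := s_zero_add n k
  have h2 := step_eq n k
  have h3 := Nat.one_le_two_pow (n := k)
  have h4 : Nat.Coprime (2 ^ k - 1) 2 :=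
    Nat.coprime_two_right.2 (Nat.Even.sub_odd h3 (by simpa [Nat.even_pow] using by omega)
      odd_one)
  have h5 : Nat.Coprime (2 ^ k - 1) (2 ^ k + 1) := by
    rw [show 2 ^ k + 1 = 2 ^ k - 1 + 2 by omega, Nat.coprime_self_add_right]
    exact h4
  have h6 : Nat.Coprime (step n k) (2 ^ k - 1) :=
    (Nat.Coprime.mul_right h5 (h4.pow_right n)).symm
  have h7 : step n k = s n k 0 + (2 ^ k - 1) := by omega
  rw [h7, Nat.coprime_self_add_right]
  rwa [h7, Nat.coprime_add_self_left] at h6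

theorem mem_GT_iff {n k w : ℕ} :
    w ∈ GT n k ↔ ∃ N p, (N, p) ∈ mersenneSums ∧ w = s n k 0 * N + step n k * p := by
  let φ : ℕ × ℕ →+ ℕ :=
    (AddMonoidHom.mulLeft (s n k 0)).coprod (AddMonoidHom.mulLeft (step n k))
  have : GT n k = mersenneSums.map φ := by
    rw [mersenneSums, AddMonoidHom.map_mclosure, ← Set.range_comp, GT]
    congr 2
    funext i
    simp [φ, s_eq n k i]
  rw [this, AddSubmonoid.mem_map]
  simp [φ, eq_comm]

/-- The element of `Apery (GT n k) (s n k 0)` that belongs to `p < s n k 0`. -/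
noncomputable def aperyElement (n k p : ℕ) : ℕ :=
  s n k 0 * mersenneLength p + step n k * p

theorem modEq_of_step_mul_modEq {n k a b c d : ℕ} (hk : 1 ≤ k)
    (h : s n k 0 * a + step n k * b ≡ s n k 0 * c + step n k * d [MOD s n k 0]) :
    b ≡ d [MOD s n k 0] := by
  have h1 : step n k * b ≡ step n k * d [MOD s n k 0] := by
    simpa [Nat.ModEq, Nat.mul_add_mod] using h
  exact Nat.ModEq.cancel_left_of_coprime (coprime_s_zero_step n hk) h1

theorem aperyElement_inj {n k : ℕ} (hk : 1 ≤ k) (p : ℕ) (hp : p < s n k 0) (q : ℕ)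
    (hq : q < s n k 0) (h : aperyElement n k p ≡ aperyElement n k q [MOD s n k 0]) : p = q :=
  (modEq_of_step_mul_modEq hk h).eq_of_lt_of_lt hp hq

theorem Apery_GT_eq {n k : ℕ} (hk : 1 ≤ k) :
    Apery (GT n k) (s n k 0) = {w | ∃ p < s n k 0, w = aperyElement n k p} := by
  have hs := s_zero_pos n k
  have hM := s_zero_le_step n k
  have red : ∀ N p, (N, p) ∈ mersenneSums →
      ∃ t ∈ GT n k, s n k 0 * (N + 1) + step n k * p = t + s n k 0 := fun N p h ↦
    ⟨_, mem_GT_iff.2 ⟨N, p, h, rfl⟩, by ring⟩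
  ext w
  constructor
  · rintro ⟨hw, hw'⟩
    obtain ⟨N, p, hNp, rfl⟩ := mem_GT_iff.1 hw
    have hlen := mersenneLength_le hNp
    have hN : N = mersenneLength p := by
      by_contra hne
      obtain ⟨N, rfl⟩ : ∃ N', N = N' + 1 := ⟨N - 1, by omega⟩
      exact hw' (red N p (mersenneSums_mono (mersenneLength_mem p) (by omega)))
    refine ⟨p, ?_, by rw [hN, aperyElement]⟩
    -- Writing `p = r + s_0 q` gives `w = s_0 (N + M q) + M r`. Here `N + M q - 1 ≥ s_0 - 1 ≥ r ≥
    -- ℓ(r)`, so `w - s_0` is still in the semigroup.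
    by_contra! hp
    set r := p % s n k 0 with hr
    set q := p / s n k 0 with hq
    have hpq : r + s n k 0 * q = p := Nat.mod_add_div _ _
    have hrlt : r < s n k 0 := Nat.mod_lt _ hs
    have hq1 : 1 ≤ q := (Nat.one_le_div_iff hs).2 hp
    have h1 : step n k * 1 ≤ step n k * q := Nat.mul_le_mul_left _ hq1
    obtain ⟨N', hN'⟩ : ∃ N', N + step n k * q = N' + 1 := ⟨N + step n k * q - 1, by omega⟩
    have hmem : (N', r) ∈ mersenneSums :=
      mersenneSums_mono (self_mem_mersenneSums r) (by omega)
    refine hw' ?_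
    have := red N' r hmem
    rw [← hN'] at this
    rw [← hpq]
    convert this using 4
    ring
  · rintro ⟨p, hp, rfl⟩
    refine ⟨mem_GT_iff.2 ⟨_, p, mersenneLength_mem p, rfl⟩, ?_⟩
    rintro ⟨t, ht, h⟩
    obtain ⟨N, p', hNp, rfl⟩ := mem_GT_iff.1 ht
    have h' : s n k 0 * mersenneLength p + step n k * p =
        s n k 0 * (N + 1) + step n k * p' := by
      rw [aperyElement] at h
      rw [h]
      ring
    have hmod : p ≡ p' [MOD s n k 0] := modEq_of_step_mul_modEq hk (congrArg (· % s n k 0) h')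
    have hp' : p' = p + s n k 0 * (p' / s n k 0) := by
      have h1 := Nat.mod_add_div p' (s n k 0)
      have h2 : p % s n k 0 = p' % s n k 0 := hmod
      rw [Nat.mod_eq_of_lt hp] at h2
      omega
    have hlen : mersenneLength p = N + 1 + step n k * (p' / s n k 0) := by
      apply Nat.eq_of_mul_eq_mul_left hs
      rw [hp'] at h'
      linarith
    have hle := mersenneLength_le_self p
    -- A zero quotient contradicts minimality of `ℓ(p)`; a positive one gives `ℓ(p) > M ≥ s_0 > p`,
    -- against `ℓ(p) ≤ p`.
    rcases Nat.eq_zero_or_pos (p' / s n k 0) with h0 | h0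
    · rw [h0, mul_zero, add_zero] at hp' hlen
      have := mersenneLength_le hNp
      rw [hp'] at this
      omega
    · have h1 : step n k * 1 ≤ step n k * (p' / s n k 0) := Nat.mul_le_mul_left _ h0
      omega

theorem Apery_GT_eq_image {n k : ℕ} (hk : 1 ≤ k) :
    Apery (GT n k) (s n k 0) =
      ((Finset.range (s n k 0)).image (aperyElement n k) : Finset ℕ) := by
  rw [Apery_GT_eq hk]
  ext w
  simp [eq_comm]

theorem Q_eq (n k : ℕ) (t : ℕ → ℕ) (L : ℕ) :
    Q n k t L = s n k 0 * digitSum t L + step n k * P t L := by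
  rw [Q, digitSum, P, Finset.mul_sum, Finset.mul_sum, ← Finset.sum_add_distrib]
  refine Finset.sum_congr rfl fun j _ ↦ ?_
  rw [s_eq n k j]
  ring

theorem IsGreedy.aperyElement_P {t : ℕ → ℕ} (ht : IsGreedy t) (n k L : ℕ) :
    aperyElement n k (P t L) = Q n k t L := by
  rw [aperyElement, Q_eq, ht.mersenneLength_P]

theorem isGreedy_of_mem_A {n d : ℕ} {t : ℕ → ℕ} (ht : t ∈ A n d) : IsGreedy t := by
  intro j
  obtain ⟨h1, h2, -, h4⟩ := ht
  by_cases hj : j ∈ Finset.Icc 1 (n + d)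
  · refine ⟨?_, h4 j hj⟩
    have := h2 j hj
    simp only [Set.mem_insert_iff, Set.mem_singleton_iff] at this
    omega
  · rw [h1 j hj]
    omega

/-- A top digit 2 would already give `P t (n + d) ≥ 2^(n+d+1) - 2`. -/
theorem mem_A_of_isGreedy {n d : ℕ} {t : ℕ → ℕ} (ht : IsGreedy t)
    (h0 : ∀ i, i ∉ Finset.Icc 1 (n + d) → t i = 0)
    (hP : P t (n + d) + 3 ≤ 2 ^ (n + d + 1)) : t ∈ A n d := by
  refine ⟨h0, fun i _ ↦ ?_, ?_, fun j _ ↦ (ht j).2⟩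
  · have := (ht i).1
    simp only [Set.mem_insert_iff, Set.mem_singleton_iff]
    omega
  · have h1 := (ht (n + d)).1
    have h2 : t (n + d) ≠ 2 := by
      intro h2
      obtain hL | ⟨L, hL⟩ : n + d = 0 ∨ ∃ L, n + d = L + 1 := by
        rcases h : n + d with _ | L
        · exact .inl rfl
        · exact .inr ⟨L, rfl⟩
      · rw [h0 _ (by simp [hL])] at h2
        omega
      · rw [hL] at hP h2
        rw [P_succ, h2, pow_succ 2 (L + 1)] at hP
        have := Nat.one_le_two_pow (n := L + 1)
        omega
    simp only [Set.mem_insert_iff, Set.mem_singleton_iff]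
    omega

/-- The Apéry set in terms of digit sequences. -/
theorem Apery_GT_eq_of_forall_mem_iff {n k d : ℕ} (hk : 1 ≤ k) {X : Set (ℕ → ℕ)}
    (hd : s n k 0 + 2 ≤ 2 ^ (n + d + 1)) (hX : ∀ t, t ∈ X ↔ t ∈ A n d ∧ P t (n + d) < s n k 0) :
    Apery (GT n k) (s n k 0) = {w | ∃ t ∈ X, w = Q n k t (n + d)} := by
  rw [Apery_GT_eq hk]
  ext w
  constructor
  · rintro ⟨p, hp, rfl⟩
    obtain ⟨t, ht, ht0, rfl⟩ := exists_isGreedy_P_eq (L := n + d) (p := p) (by omega)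
    exact ⟨t, (hX t).2 ⟨mem_A_of_isGreedy ht ht0 (by omega), hp⟩, ht.aperyElement_P n k _⟩
  · rintro ⟨t, ht, rfl⟩
    obtain ⟨h1, h2⟩ := (hX t).1 ht
    exact ⟨_, h2, ((isGreedy_of_mem_A h1).aperyElement_P n k _).symm⟩

/-! ### The sets of digit sequences -/

/-- Here `s_0 = 2^(n+1) + 2^n - 1`, so a top digit 1 leaves the condition `P t n < 2^n`, read off
from `t n`. -/
theorem mem_R_iff {n : ℕ} (hn : n ≠ 0) (t : ℕ → ℕ) :
    t ∈ R n ↔ t ∈ A n 1 ∧ P t (n + 1) < s n 1 0 := by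
  refine and_congr_right fun hA ↦ ?_
  have hg := isGreedy_of_mem_A hA
  have hlast := hA.2.2.1
  obtain ⟨m, rfl⟩ := Nat.exists_eq_succ_of_ne_zero hn
  rw [Nat.succ_eq_add_one] at *
  have hs := s_zero_add (m + 1) 1
  have h1 := hg.P_add_two_le m
  have hp1 := pow_succ 2 (m + 1)
  have htn := (hg (m + 1)).1
  rw [P_succ, P_succ]
  simp only [Set.mem_insert_iff, Set.mem_singleton_iff] at hlast ⊢
  rcases hlast with h | h
  · rw [h]
    simp only [zero_ne_one, or_false, implies_true, IsEmpty.forall_iff, mul_zero, add_zero,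
      true_and, true_iff]
    have := hg.P_add_two_le (m + 1)
    rw [P_succ] at this
    omega
  · rw [h]
    simp only [one_ne_zero, false_or, imp_false, forall_const, true_and, mul_one]
    interval_cases h2 : t (m + 1)
    · simp; omega
    · have : (∀ i, 1 ≤ i → i < m + 1 → t i = 0) ↔ P t m = 0 := by
        simp [P_eq_zero_iff]
      rw [this]
      simp
      omega
    · simp
      omega

/-- A top digit 1 leaves less than `2^n - 2^k + 2` for the other digits. As `2^k ≥ 4`, this excludes
nonzero digits from index `n` on and also `t (n - 1) = 2`. -/
theorem mem_R₁_iff {n k : ℕ} (hk : 2 ≤ k) (hkn : k < n) (t : ℕ → ℕ) :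
    t ∈ R₁ n k ↔ t ∈ A n k ∧ P t (n + k) < s n k 0 := by
  have hδ : delta n k = k := by rw [delta, if_neg (by omega), if_pos hkn.le]
  rw [R₁, Set.mem_ofPred_eq, hδ]
  refine and_congr_right fun hA ↦ ?_
  have hg := isGreedy_of_mem_A hA
  have hlast := hA.2.2.1
  have hs := s_zero_add n k
  obtain ⟨m, rfl⟩ : ∃ m, n = m + 2 := ⟨n - 2, by omega⟩
  obtain ⟨L, hL⟩ : ∃ L, m + 2 + k = L + 1 := ⟨m + 1 + k, by omega⟩
  rw [hL] at hs hlast ⊢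
  have h4 : 2 ^ 2 ≤ 2 ^ k := Nat.pow_le_pow_right two_pos hk
  have hkm : 2 ^ k ≤ 2 ^ (m + 1) := Nat.pow_le_pow_right two_pos (by omega)
  have hp2 : 2 ^ (m + 2) = 2 ^ (m + 1) * 2 := pow_succ 2 (m + 1)
  have hpL : 2 ^ (m + 2) ≤ 2 ^ (L + 1) := Nat.pow_le_pow_right two_pos (by omega)
  have hPL := hg.P_add_two_le L
  have hPm := hg.P_add_two_le m
  simp only [Nat.add_sub_cancel, show m + 2 - 1 = m + 1 by omega, Set.mem_insert_iff,
    Set.mem_singleton_iff] at hlast ⊢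
  rw [P_succ]
  rcases hlast with h | h
  · rw [h]
    simp
    omega
  rw [h]
  simp only [forall_const, mul_one]
  have htn := (hg (m + 1)).1
  constructor
  · rintro ⟨h1, h2, h3⟩
    have := P_eq_of_eq_zero (t := t) (show m + 1 ≤ L by omega) h1
    rw [P_succ] at this
    rcases h2 with h2 | h2
    · rw [h2] at this
      omega
    · have h5 := h3 h2
      rw [h2] at this
      omega
  · intro hlt
    have hz : ∀ i, m + 2 ≤ i → i ≤ L → t i = 0 := by
      intro i hi hiL
      by_contra hti
      have := le_P (by omega) hiL hti
      have := Nat.pow_le_pow_right (n := 2) two_pos hi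
      omega
    have := P_eq_of_eq_zero (t := t) (show m + 1 ≤ L by omega) hz
    rw [P_succ] at this
    refine ⟨hz, ?_, fun h3 ↦ ?_⟩
    · interval_cases h2 : t (m + 1) <;> omega
    · rw [h3] at this
      omega

/-- For `k = n`, a top digit 1 leaves at most 1 for the other digits. -/
theorem mem_R₂_iff {n : ℕ} (hn : 1 ≤ n) (t : ℕ → ℕ) :
    t ∈ R₂ n n ↔ t ∈ A n n ∧ P t (n + n) < s n n 0 := by
  have hδ : delta n n = n := by rw [delta, if_neg (by omega), if_pos le_rfl]
  rw [R₂, Set.mem_ofPred_eq, hδ]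
  refine and_congr_right fun hA ↦ ?_
  have hg := isGreedy_of_mem_A hA
  have hlast := hA.2.2.1
  have hs := s_zero_add n n
  obtain ⟨L, hL⟩ : ∃ L, n + n = L + 1 := ⟨n + n - 1, by omega⟩
  have hP1 : P t 1 = t 1 := by simp [P]
  have hpL := Nat.one_le_two_pow (n := L + 1)
  have hPL := hg.P_add_two_le L
  rw [hL] at hs hlast
  rw [two_mul, hL]
  simp only [Nat.add_sub_cancel, Set.mem_insert_iff, Set.mem_singleton_iff] at hlast ⊢
  rw [P_succ]
  rcases hlast with h | h
  · rw [h]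
    simp
    omega
  rw [h]
  simp only [forall_const, mul_one]
  constructor
  · rintro ⟨h1, h2⟩
    have := P_eq_of_eq_zero (t := t) (show 1 ≤ L by omega) h2
    omega
  · intro hlt
    have h2 : ∀ i, 2 ≤ i → i ≤ L → t i = 0 := by
      intro i hi hiL
      by_contra hti
      have := le_P (by omega) hiL hti
      have := Nat.pow_le_pow_right (n := 2) two_pos hi
      omega
    have := P_eq_of_eq_zero (t := t) (show 1 ≤ L by omega) h2
    exact ⟨by omega, h2⟩

theorem forall_eq_one_or_exists_last_ne_one (t : ℕ → ℕ) {a L : ℕ} :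
    (∀ i, a ≤ i → i ≤ L → t i = 1) ∨
      ∃ j, a ≤ j ∧ j ≤ L ∧ t j ≠ 1 ∧ ∀ i, j + 1 ≤ i → i ≤ L → t i = 1 := by
  by_contra! ⟨⟨i, hai, hiL, hi⟩, h⟩
  have : ∀ d, ∀ j, a ≤ j → j ≤ L → L - j = d → t j = 1 := by
    intro d
    induction d using Nat.strong_induction_on with
    | _ d ih =>
      rintro j haj hjL rfl
      by_contra hj
      obtain ⟨l, hl, hlL, hne⟩ := h j haj hjL hj
      exact hne (ih (L - l) (by omega) l (by omega) hlL rfl)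
  exact hi (this _ i hai hiL rfl)

/-- With `d = k - 1`, ones at `d+1, …, n+d` contribute `2^(n+d+1) - 2^(d+1) - n`, leaving at most
`2^n + n` for `P t d`. Otherwise the last digit there that is not 1 decides: a 0 puts the sum below
`s_0`, a 2 puts it at or above. -/
theorem mem_R₃_iff {n k : ℕ} (hn : n ≠ 0) (hnk : n < k) (t : ℕ → ℕ) :
    t ∈ R₃ n k ↔ t ∈ A n (k - 1) ∧ P t (n + (k - 1)) < s n k 0 := by
  have hδ : delta n k = k - 1 := by rw [delta, if_neg hn, if_neg (by omega)]
  rw [R₃, Set.mem_ofPred_eq, hδ]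
  refine and_congr_right fun hA ↦ ?_
  have hg := isGreedy_of_mem_A hA
  have hlast := hA.2.2.1
  have hs := s_zero_add n k
  obtain ⟨d, rfl⟩ : ∃ d, k = d + 1 := ⟨k - 1, by omega⟩
  simp only [Nat.add_sub_cancel] at hlast ⊢
  rw [← add_assoc] at hs
  have hones := fun h ↦ P_of_eq_one (t := t) (show d ≤ n + d by omega) h
  have hnd : 2 ^ (n + 1) ≤ 2 ^ (d + 1) := Nat.pow_le_pow_right two_pos (by omega)
  have hn1 := pow_succ 2 n
  have hlt : n < 2 ^ n := Nat.lt_two_pow_self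
  have htwo : ∀ j, d + 1 ≤ j → j ≤ n + d - 1 → t j = 2 →
      (∀ i, j + 1 ≤ i → i ≤ n + d → t i = 1) → s n (d + 1) 0 ≤ P t (n + d) := by
    intro j h1 h2 h3 h4
    have h5 := P_of_eq_one (show j ≤ n + d by omega) h4
    obtain ⟨j, rfl⟩ : ∃ i, j = i + 1 := ⟨j - 1, by omega⟩
    rw [P_succ, P_eq_zero_iff.2 fun i hi (hij : i ≤ j) ↦ (hg (j + 1)).2 h3 i hi (by omega), h3,
      pow_succ 2 (j + 1)] at h5
    have h6 := Nat.one_le_two_pow (n := j + 1)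
    -- The inequality fails for `n = 1`, but then no index `j` is in range.
    have h7 : n + 1 < 2 ^ n ∨ n = 1 := by
      rcases Nat.lt_or_ge n 2 with h | h
      · omega
      · left
        have h8 : n - 1 < 2 ^ (n - 1) := Nat.lt_two_pow_self
        have h9 : 2 ^ n = 2 ^ (n - 1) * 2 := by
          rw [← pow_succ, Nat.sub_add_cancel (by omega)]
        omega
    omega
  constructor
  · rintro ⟨h1, h2⟩
    rcases forall_eq_one_or_exists_last_ne_one t (a := d + 1) (L := n + d) with h | h
    · have := h1 h
      have := hones h
      omega
    · obtain ⟨j, hdj, hjL, hj, hjone⟩ := h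
      have hj0 : t j = 0 := by
        by_contra hj0
        have hj2 : t j = 2 := by
          have := (hg j).1
          omega
        rcases Nat.lt_or_ge j (n + d) with h | h
        · exact h2 ⟨j, hdj, by omega, hj2, hjone⟩
        · have : j = n + d := by omega
          subst this
          simp [hj2] at hlast
      have h5 := P_of_eq_one hjL hjone
      obtain ⟨j, rfl⟩ : ∃ i, j = i + 1 := ⟨j - 1, by omega⟩
      rw [P_succ, hj0, pow_succ 2 (j + 1)] at h5
      have h6 := hg.P_add_two_le j
      have h7 : 2 ^ (d + 1) ≤ 2 ^ (j + 1) := Nat.pow_le_pow_right two_pos hdj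
      omega
  · intro hP
    refine ⟨fun h ↦ ?_, ?_⟩
    · have := hones h
      omega
    · rintro ⟨j, h1, h2, h3, h4⟩
      have := htwo j h1 h2 h3 h4
      omega

/-- For `n < k` this amounts to `2^n + 3 ≤ 2^k`, which fails only for `n = 1`, `k = 2`; hence the
exceptional case. -/
theorem s_zero_add_two_le {n k : ℕ} (hn : n ≠ 0) (hk : 1 ≤ k) (h : n < k → k ≠ 2) :
    s n k 0 + 2 ≤ 2 ^ (n + delta n k + 1) := by
  have hs := s_zero_add n k
  have hn2 : 2 ^ 1 ≤ 2 ^ n := Nat.pow_le_pow_right two_pos (by omega)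
  have hk2 : 2 ^ 1 ≤ 2 ^ k := Nat.pow_le_pow_right two_pos hk
  by_cases hkn : k ≤ n
  · rw [delta, if_neg hn, if_pos hkn, pow_succ]
    have h1 : 2 ^ (n + 1) ≤ 2 ^ (n + k) := Nat.pow_le_pow_right two_pos (by omega)
    rw [pow_succ] at h1
    omega
  · rw [delta, if_neg hn, if_neg hkn, show n + (k - 1) + 1 = n + k by omega]
    have h1 : 2 ^ (n + 1) ≤ 2 ^ k := Nat.pow_le_pow_right two_pos (by omega)
    have h3 : 2 ^ 3 ≤ 2 ^ k := Nat.pow_le_pow_right two_pos (by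
      have := h (by omega)
      omega)
    rw [pow_succ] at h1
    rcases Nat.lt_or_ge n 2 with h2 | h2
    · have : n = 1 := by omega
      subst this
      omega
    · have : 2 ^ 2 ≤ 2 ^ n := Nat.pow_le_pow_right two_pos h2
      omega

/-! ### The two exceptional cases -/

theorem mersenneLength_zero : mersenneLength 0 = 0 :=
  Nat.le_zero.1 (mersenneLength_le_self 0)

theorem mersenneLength_one : mersenneLength 1 = 1 :=
  mersenneLength_eq (self_mem_mersenneSums 1) (by simp [bitCount])

theorem Apery_GT_zero {k : ℕ} (hk : 1 ≤ k) : Apery (GT 0 k) (s 0 k 0) = {0, s 0 k 1} := by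
  have hs : s 0 k 0 = 2 := by
    have := s_zero_add 0 k
    simp only [zero_add, pow_zero] at this
    omega
  rw [Apery_GT_eq_image hk, hs, s_eq 0 k 1]
  simp [Finset.range_add_one, aperyElement, mersenneLength_zero, mersenneLength_one, Set.pair_comm]

/-- Here `p = 6 = 3 + 3` would need the top digit 2, which `A` forbids, so the seven lengths are
computed directly. -/
theorem Apery_GT_one_two : Apery (GT 1 2) (s 1 2 0) = {0, 17, 34, 37, 54, 71, 74} := by
  have hs : s 1 2 0 = 7 := rfl
  have hM : step 1 2 = 10 := rfl
  have h2 : mersenneLength 2 = 2 :=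
    mersenneLength_eq (self_mem_mersenneSums 2) (by simp [bitCount])
  have h3 : mersenneLength 3 = 1 :=
    mersenneLength_eq (one_mem_mersenneSums 2) (by simp [bitCount])
  have h4 : mersenneLength 4 = 2 :=
    mersenneLength_eq (mersenneSums.add_mem (one_mem_mersenneSums 2) (one_mem_mersenneSums 1))
      (by simp [bitCount])
  have h5 : mersenneLength 5 = 3 :=
    mersenneLength_eq (mersenneSums.add_mem (one_mem_mersenneSums 2) (self_mem_mersenneSums 2))
      (by simp [bitCount])
  have h6 : mersenneLength 6 = 2 :=
    mersenneLength_eq (mersenneSums.add_mem (one_mem_mersenneSums 2) (one_mem_mersenneSums 2))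
      (by simp [bitCount])
  rw [Apery_GT_eq_image (by norm_num), hs]
  ext w
  simp only [Finset.range_add_one, Finset.range_zero, Finset.image_insert, Finset.image_empty,
    aperyElement, hs, hM, mersenneLength_zero, mersenneLength_one, h2, h3, h4, h5, h6,
    Finset.coe_insert, Finset.coe_empty, Set.mem_insert_iff, Set.mem_singleton_iff,
    Set.mem_empty_iff_false]
  norm_num
  tauto

end GenThabit

theorem mainTheorem4 (n k : ℕ) (hk : 1 ≤ k) :
    (n = 0 →
      GenThabit.Apery (GenThabit.GT n k) (GenThabit.s n k 0) = {0, GenThabit.s n k 1}) ∧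
    (n ≠ 0 → k = 1 →
      GenThabit.Apery (GenThabit.GT n k) (GenThabit.s n k 0) =
        {w | ∃ t ∈ GenThabit.R n, w = GenThabit.Q n k t (n + 1)}) ∧
    (2 ≤ k → k < n →
      GenThabit.Apery (GenThabit.GT n k) (GenThabit.s n k 0) =
        {w | ∃ t ∈ GenThabit.R₁ n k, w = GenThabit.Q n k t (n + GenThabit.delta n k)}) ∧
    (n = k → 1 ≤ k →
      GenThabit.Apery (GenThabit.GT n k) (GenThabit.s n k 0) =
        {w | ∃ t ∈ GenThabit.R₂ n k, w = GenThabit.Q n k t (n + GenThabit.delta n k)}) ∧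
    (n ≠ 0 → k ≠ 2 → n < k →
      GenThabit.Apery (GenThabit.GT n k) (GenThabit.s n k 0) =
        {w | ∃ t ∈ GenThabit.R₃ n k, w = GenThabit.Q n k t (n + GenThabit.delta n k)}) ∧
    (n = 1 → k = 2 →
      GenThabit.Apery (GenThabit.GT n k) (GenThabit.s n k 0) = {0, 17, 34, 37, 54, 71, 74}) ∧
    (GenThabit.Apery (GenThabit.GT n k) (GenThabit.s n k 0)).Finite ∧
    (GenThabit.Apery (GenThabit.GT n k) (GenThabit.s n k 0)).ncard = GenThabit.s n k 0 ∧
    ((GenThabit.GT n k : Set ℕ)ᶜ).Finite ∧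
    (GenThabit.genus (GenThabit.GT n k) : ℚ) =
      1 / (GenThabit.s n k 0 : ℚ) *
          (∑ᶠ w ∈ GenThabit.Apery (GenThabit.GT n k) (GenThabit.s n k 0), (w : ℚ)) -
        ((GenThabit.s n k 0 : ℚ) - 1) / 2 := by
  have hpos := GenThabit.s_zero_pos n k
  have hinj := GenThabit.aperyElement_inj (n := n) hk
  have hmem : GenThabit.s n k 0 ∈ GenThabit.GT n k := AddSubmonoid.subset_closure ⟨0, rfl⟩
  refine ⟨?_, ?_, ?_, ?_, ?_, ?_, ?_, ?_, ?_, ?_⟩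
  · rintro rfl
    exact GenThabit.Apery_GT_zero hk
  · rintro hn rfl
    refine GenThabit.Apery_GT_eq_of_forall_mem_iff hk ?_ (GenThabit.mem_R_iff hn)
    have := GenThabit.s_zero_add_two_le hn hk (by omega)
    rwa [GenThabit.delta, if_neg hn, if_pos (by omega)] at this
  · intro h2 hkn
    have := GenThabit.s_zero_add_two_le (n := n) (k := k) (by omega) hk (by omega)
    rw [GenThabit.delta, if_neg (by omega), if_pos (by omega)] at this ⊢
    exact GenThabit.Apery_GT_eq_of_forall_mem_iff hk this (GenThabit.mem_R₁_iff h2 hkn)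
  · rintro rfl -
    have := GenThabit.s_zero_add_two_le (n := n) (k := n) (by omega) hk (by omega)
    rw [GenThabit.delta, if_neg (by omega), if_pos (by omega)] at this ⊢
    exact GenThabit.Apery_GT_eq_of_forall_mem_iff hk this (GenThabit.mem_R₂_iff hk)
  · intro hn h2 hnk
    have := GenThabit.s_zero_add_two_le hn hk fun _ ↦ h2
    rw [GenThabit.delta, if_neg hn, if_neg (by omega)] at this ⊢
    exact GenThabit.Apery_GT_eq_of_forall_mem_iff hk this (GenThabit.mem_R₃_iff hn hnk)
  · rintro rfl rfl
    exact GenThabit.Apery_GT_one_two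
  · rw [GenThabit.Apery_GT_eq_image hk]
    exact Finset.finite_toSet _
  · rw [GenThabit.Apery_GT_eq_image hk, Set.ncard_coe_finset, Finset.card_image_of_injOn,
      Finset.card_range]
    intro p hp q hq h
    exact hinj p (by simpa using hp) q (by simpa using hq) (by rw [h])
  · rw [GenThabit.compl_eq_image hpos hmem (GenThabit.Apery_GT_eq_image hk) hinj]
    exact Finset.finite_toSet _
  · exact GenThabit.genus_eq hpos hmem (GenThabit.Apery_GT_eq_image hk) hinj
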